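/- Let $(\Omega,\mathcal F,\mathbb P)$ be a probability space, let $\nu>0$, and let $U(x,t)=(U^1,U^2,U^3)(x,t)$, $x\in\mathbb R^3$, $t\ge 0$, be a random field whose sample paths are $C^\infty$ on $\mathbb R^3\times[0,\infty)$ and solve, with some random pressure $P(x,t)$ differentiable in $x$, the incompressible Navier–Stokes equations without external force $$\frac{\partial U^i}{\partial t}+\sum_{j}U^j\frac{\partial U^i}{\partial x^j}=\nu\Delta U^i-\frac{\partial P}{\partial x^i}\quad(t>0,\ i=1,2,3),\qquad \sum_j\frac{\partial U^j}{\partial x^j}=0\quad (t\ge 0).$$ Let $W=\nabla\wedge U$ be the vorticity. Suppose that 1. for every $t\ge 0$ the mean vorticity $\mathbb E[W(x,t)]$ does not depend on $x$; 2. $W$ is weakly isotropic: for all $x\in\mathbb R^3$, $t\ge0$ and all $i,k$, the derivative $\frac{\partial W^i}{\partial x^k}(x,t)$ is integrable and $\mathbb E\big[\frac{\partial W^i}{\partial x^k}(x,t)\,\big|\,W(x,t)\big]=0$ almost surely; 3. $W$ is Gaussian: for every $t\ge 0$, $\{W(x,t):x\in\mathbb R^3\}$ is a Gaussian random field, i.e.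 all its finite-dimensional distributions are (possibly degenerate) Gaussian. Then for every $t\ge 0$ the distribution of the random vector $W(x,t)$ is independent of $x$: $W(x,t)$ and $W(y,t)$ have the same law for all $x,y\in\mathbb R^3$. -/

import Mathlib

open MeasureTheory ProbabilityTheory

noncomputable section

namespace Turbulence

/-- Three-dimensional Euclidean space. -/
abbrev Space : Type := EuclideanSpace ℝ (Fin 3)

/-- The partial derivative `∂f/∂xᵏ` at `x`. -/
def pd (k : Fin 3) (f : Space → ℝ) (x : Space) : ℝ :=
  fderiv ℝ f x (EuclideanSpace.single k 1)

/-- The curl `∇ ∧ v` of a vector field. -/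
def curl (v : Space → Space) (x : Space) : Space :=
  !₂[pd 1 (fun y => v y 2) x - pd 2 (fun y => v y 1) x,
     pd 2 (fun y => v y 0) x - pd 0 (fun y => v y 2) x,
     pd 0 (fun y => v y 1) x - pd 1 (fun y => v y 0) x]

/-- `U` is the velocity and `P` the pressure of an incompressible flow with viscosity `ν`
and no external force, in `ℝ³` and for times `t ≥ 0`: `U` is a random field whose sample paths
are smooth up to time `0` and solve the Navier-Stokes equations. -/
structure IsRandomFlow {Ω : Type*} [MeasurableSpace Ω] (ν : ℝ)
    (U : Space → ℝ → Ω → Space) (P : Space → ℝ → Ω → ℝ) : Prop where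
  measurable_velocity : ∀ x t, 0 ≤ t → Measurable (U x t)
  smooth_velocity : ∀ ω,
    ContDiffOn ℝ ((⊤ : ℕ∞) : WithTop ℕ∞) (fun z : Space × ℝ => U z.1 z.2 ω) (Set.univ ×ˢ Set.Ici 0)
  differentiable_pressure : ∀ ω t, 0 < t → Differentiable ℝ (fun x => P x t ω)
  momentum : ∀ ω x t, 0 < t → ∀ i : Fin 3,
    deriv (fun s => U x s ω i) t + ∑ j : Fin 3, U x t ω j * pd j (fun y => U y t ω i) x =
      ν * Laplacian.laplacian (fun y => U y t ω i) x - pd i (fun y => P y t ω) x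
  divergence_free : ∀ ω x t, 0 ≤ t → ∑ j : Fin 3, pd j (fun y => U y t ω j) x = 0

/-- The vorticity `W = ∇ ∧ U` of a random velocity field. -/
def vorticity {Ω : Type*} (U : Space → ℝ → Ω → Space) (x : Space) (t : ℝ) (ω : Ω) : Space :=
  curl (fun y => U y t ω) x

/-- Weak isotropy: `E[∇W(x,t) | W(x,t)] = 0` for all `x` and all `t ≥ 0`, that is, all first
spatial derivatives of all components of `W` are integrable and have conditional expectation
zero given the sigma-algebra generated by `W(x,t)`. -/
def WeaklyIsotropic {Ω : Type*} [MeasurableSpace Ω] (μ : Measure Ω)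
    (W : Space → ℝ → Ω → Space) : Prop :=
  ∀ x t, 0 ≤ t → ∀ i k : Fin 3,
    Integrable (fun ω => pd k (fun y => W y t ω i) x) μ ∧
      μ[fun ω => pd k (fun y => W y t ω i) x | MeasurableSpace.comap (W x t) inferInstance]
        =ᵐ[μ] 0

end Turbulence

end

open MeasureTheory ProbabilityTheory Filter Topology

namespace Turbulence

section CondExp

variable {Ω : Type*}

/-! A Gaussian law is determined by the mean and variance of its linear functionals, and the means
are constant by hypothesis, so only `E[⟨u, W⟩²]` has to be shown constant in space. Along a line its
derivative is formally `2 E[⟨u, W⟩ ∂⟨u, W⟩]`, which vanishes: conditioning on `W` pulls out `⟨u,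
W⟩`, and weak isotropy annihilates the rest.

The work lies in differentiating under the expectation, since only pathwise smoothness is given.
Gaussianity supplies this: for centred Gaussian variables almost sure convergence to zero forces
`L²` convergence (`tendsto_eLpNorm_of_hasGaussianLaw`), so the difference quotients converge in `L²`
(`exists_hasDerivAt_toLp`). The dynamics play no role; the flow serves only through its regularity
and measurability. -/

lemma integral_mul_eq_zero_of_condExp_eq_zero {m m₀ : MeasurableSpace Ω} {μ : Measure[m₀] Ω}
    (hm : m ≤ m₀) [SigmaFinite (μ.trim hm)] {f g : Ω → ℝ} (hg : StronglyMeasurable[m] g)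
    (hfg : Integrable (f * g) μ) (hf : Integrable f μ) (h : μ[f | m] =ᵐ[μ] 0) :
    ∫ ω, f ω * g ω ∂μ = 0 := by
  calc ∫ ω, f ω * g ω ∂μ = ∫ ω, (μ[f * g | m]) ω ∂μ := (integral_condExp hm).symm
    _ = ∫ ω, (0 : ℝ) ∂μ := by
        refine integral_congr_ae ?_
        filter_upwards [condExp_mul_of_stronglyMeasurable_right hg hfg hf, h] with ω h1 h2
        simp [h1, h2]
    _ = 0 := by simp

lemma condExp_finsetSum_mul_eq_zero {m m₀ : MeasurableSpace Ω} {μ : Measure[m₀] Ω}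
    {ι : Type*} (I : Finset ι) (a : ι → ℝ) {f : ι → Ω → ℝ} (hf : ∀ i ∈ I, Integrable (f i) μ)
    (h : ∀ i ∈ I, μ[f i | m] =ᵐ[μ] 0) :
    μ[fun ω => ∑ i ∈ I, a i * f i ω | m] =ᵐ[μ] 0 := by
  have hsum : (fun ω => ∑ i ∈ I, a i * f i ω) = ∑ i ∈ I, a i • f i := by
    ext ω; simp
  rw [hsum]
  refine (condExp_finsetSum (fun i hi => (hf i hi).smul (a i)) m).trans ?_
  have hall : ∀ᵐ ω ∂μ, ∀ i ∈ I, (μ[a i • f i | m]) ω = 0 := by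
    rw [eventually_all_finset]
    intro i hi
    filter_upwards [condExp_smul (μ := μ) (a i) (f i) m, h i hi] with ω h1 h2
    simp [h1, h2]
  filter_upwards [hall] with ω hω
  simp only [Finset.sum_apply, Pi.zero_apply]
  exact Finset.sum_eq_zero hω

end CondExp

section Gaussian

variable {Ω : Type*} [MeasurableSpace Ω] {μ : Measure Ω}

/-- Centred Gaussian variables that converge to zero almost surely converge to zero in `L²`. -/
lemma tendsto_eLpNorm_of_hasGaussianLaw {ι : Type*} {l : Filter ι} [l.IsCountablyGenerated]
    {G : ι → Ω → ℝ} (hG : ∀ i, HasGaussianLaw (G i) μ) (hmean : ∀ i, ∫ ω, G i ω ∂μ = 0)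
    (hlim : ∀ᵐ ω ∂μ, Tendsto (fun i => G i ω) l (𝓝 0)) :
    Tendsto (fun i => eLpNorm (G i) 2 μ) l (𝓝 0) := by
  rcases isEmpty_or_nonempty ι with hι | ⟨⟨i₀⟩⟩
  · rw [Filter.filter_eq_bot_of_isEmpty l]; exact tendsto_bot
  have : IsProbabilityMeasure μ := (hG i₀).isProbabilityMeasure
  -- For a centred Gaussian the characteristic function at 1 encodes the variance, and bounded
  -- convergence controls its limit without any moment bound.
  have hchar : ∀ i, charFun (μ.map (G i)) 1 = (Real.exp (-Var[G i; μ] / 2) : ℂ) := by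
    intro i
    rw [(hG i).charFun_map_eq]
    simp [hmean i, neg_div]
  have hint : ∀ i, charFun (μ.map (G i)) 1 = ∫ ω, Complex.exp (G i ω * Complex.I) ∂μ := by
    intro i
    rw [charFun_apply_real, integral_map (hG i).aemeasurable (by fun_prop)]
    simp
  have h1 : Tendsto (fun i => charFun (μ.map (G i)) 1) l (𝓝 1) := by
    simp_rw [hint]
    have := tendsto_integral_filter_of_dominated_convergence (μ := μ) (l := l)
      (F := fun i ω => Complex.exp (G i ω * Complex.I)) (f := fun _ => 1) (fun _ => 1)
      (.of_forall fun i => by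
        have := (hG i).aemeasurable
        exact AEMeasurable.aestronglyMeasurable (by fun_prop))
      (.of_forall fun i => .of_forall fun ω => by simp [Complex.norm_exp_ofReal_mul_I])
      (integrable_const _)
      (by
        filter_upwards [hlim] with ω hω
        have hc : Continuous fun r : ℝ => Complex.exp (r * Complex.I) := by fun_prop
        simpa [Function.comp_def] using (hc.tendsto 0).comp hω)
    simpa using this
  have h2 : Tendsto (fun i => Var[G i; μ]) l (𝓝 0) := by
    have h3 : Tendsto (fun i => -2 * Real.log ‖charFun (μ.map (G i)) 1‖) l (𝓝 0) := by
      have := ((h1.norm).log (by simp)).const_mul (-2)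
      simpa using this
    refine h3.congr fun i => ?_
    rw [hchar, Complex.norm_real, Real.norm_of_nonneg (Real.exp_pos _).le, Real.log_exp]
    ring
  have h4 : ∀ i, eLpNorm (G i) 2 μ = ENNReal.ofReal (Real.sqrt (Var[G i; μ])) := by
    intro i
    rw [(hG i).memLp_two.eLpNorm_eq_integral_rpow_norm (by simp) (by simp),
      variance_of_integral_eq_zero (hG i).aemeasurable (hmean i), Real.sqrt_eq_rpow]
    simp
  simp_rw [h4]
  simpa using ENNReal.tendsto_ofReal (h2.sqrt)

lemma aemeasurable_of_hasDerivAt {F : ℝ → Ω → ℝ} {f : Ω → ℝ} {s : ℝ}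
    (hF : ∀ r, AEMeasurable (F r) μ) (hd : ∀ ω, HasDerivAt (fun r => F r ω) (f ω) s) :
    AEMeasurable f μ :=
  aemeasurable_of_tendsto_metrizable_ae (𝓝[≠] s)
    (f := fun r ω => slope (fun r => F r ω) s r)
    (fun r => by
      simp only [slope_def_field]
      exact ((hF r).sub (hF s)).div_const _)
    (.of_forall fun ω => hasDerivAt_iff_tendsto_slope.1 (hd ω))

lemma measurable_of_hasDerivAt {F : ℝ → Ω → ℝ} {f : Ω → ℝ} {s : ℝ}
    (hF : ∀ r, Measurable (F r)) (hd : ∀ ω, HasDerivAt (fun r => F r ω) (f ω) s) :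
    Measurable f :=
  measurable_of_tendsto_metrizable' (𝓝[≠] s)
    (f := fun r ω => slope (fun r => F r ω) s r)
    (fun r => by
      simp only [slope_def_field]
      exact ((hF r).sub (hF s)).div_const _)
    (tendsto_pi_nhds.2 fun ω => hasDerivAt_iff_tendsto_slope.1 (hd ω))

/-- A Gaussian process indexed by `ℝ` with constant mean and differentiable paths is
differentiable as a curve in `L²`. -/
lemma exists_hasDerivAt_toLp {X : ℝ → Ω → ℝ} {X' : Ω → ℝ} {c s : ℝ}
    (hX : IsGaussianProcess X μ) (hmean : ∀ r, ∫ ω, X r ω ∂μ = c)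
    (hd : ∀ ω, HasDerivAt (fun r => X r ω) (X' ω) s) :
    ∃ hX' : MemLp X' 2 μ,
      HasDerivAt (fun r => (hX.hasGaussianLaw_eval r).memLp_two.toLp (X r)) (hX'.toLp X') s := by
  have hmeas : AEMeasurable X' μ := aemeasurable_of_hasDerivAt hX.aemeasurable hd
  have hL : ∀ r, MemLp (X r) 2 μ := fun r => (hX.hasGaussianLaw_eval r).memLp_two
  have hI : ∀ r, Integrable (X r) μ := fun r => (hX.hasGaussianLaw_eval r).integrable
  let Q : ℝ → Ω → ℝ := fun r => (r - s)⁻¹ • (X r - X s)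
  have hQ : ∀ r, MemLp (Q r) 2 μ := fun r => ((hL r).sub (hL s)).const_smul _
  have hQlim : ∀ ω, Tendsto (fun r => Q r ω) (𝓝[≠] s) (𝓝 (X' ω)) := fun ω =>
    hasDerivAt_iff_tendsto_slope.1 (hd ω)
  -- Differences of quotients, unlike `Q r - X'`, are visibly Gaussian: each is linear in the values
  -- of `X` at three points. This gives the Cauchy property before `X'` is known to be in `L²`.
  have hgauss : IsGaussianProcess (fun p : ℝ × ℝ => Q p.1 - Q p.2) μ := by
    classical
    refine hX.of_isGaussianProcess fun p => ⟨{s, p.1, p.2},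
      (p.1 - s)⁻¹ • (ContinuousLinearMap.proj ⟨p.1, by simp⟩ -
          ContinuousLinearMap.proj ⟨s, by simp⟩) -
        (p.2 - s)⁻¹ • (ContinuousLinearMap.proj ⟨p.2, by simp⟩ -
          ContinuousLinearMap.proj ⟨s, by simp⟩), fun ω => ?_⟩
    simp [Q]
  have hQmean : ∀ r, ∫ ω, Q r ω ∂μ = 0 := by
    intro r
    simp only [Q, Pi.smul_apply, Pi.sub_apply]
    rw [integral_smul, integral_sub (hI r) (hI s), hmean, hmean]
    simp
  have hprob : IsProbabilityMeasure μ := hX.isProbabilityMeasure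
  have hcauchy := tendsto_eLpNorm_of_hasGaussianLaw (μ := μ) (l := 𝓝[≠] s ×ˢ 𝓝[≠] s)
    (G := fun p => Q p.1 - Q p.2)
    (fun p => hgauss.hasGaussianLaw_eval p)
    (fun p => by
      simp only [Pi.sub_apply]
      rw [integral_sub ((hQ _).integrable (by simp)) ((hQ _).integrable (by simp)),
        hQmean, hQmean, sub_zero])
    (.of_forall fun ω => by
      simpa [Function.comp_def] using
        ((hQlim ω).comp tendsto_fst).sub ((hQlim ω).comp tendsto_snd))
  have hlim : Tendsto (fun r => eLpNorm (Q r - X') 2 μ) (𝓝[≠] s) (𝓝 0) := by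
    rw [ENNReal.tendsto_nhds_zero] at hcauchy ⊢
    intro ε hε
    -- With `r` fixed, let `r'` tend to `s`: Fatou carries the Cauchy bound over to `Q r - X'`.
    filter_upwards [(hcauchy ε hε).curry] with r hr
    exact Lp.eLpNorm_le_of_ae_tendsto (f := fun r' => Q r - Q r') hr
      (fun r' => ((hQ r).sub (hQ r')).aestronglyMeasurable)
      (.of_forall fun ω => by simpa using (hQlim ω).const_sub (Q r ω))
  have hX' : MemLp X' 2 μ := by
    -- A single quotient at finite `L²` distance from `X'` already puts `X'` in `L²`.
    obtain ⟨r, hr⟩ := (hlim.eventually (gt_mem_nhds (zero_lt_one (α := ENNReal)))).exists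
    have hsub : MemLp (Q r - X') 2 μ :=
      ⟨(hQ r).aestronglyMeasurable.sub hmeas.aestronglyMeasurable, hr.trans ENNReal.one_lt_top⟩
    simpa using (hQ r).sub hsub
  refine ⟨hX', hasDerivAt_iff_tendsto_slope.2 ?_⟩
  exact (Lp.tendsto_Lp_iff_tendsto_eLpNorm'' Q hQ X' hX').2 hlim

/-- The second moment of a Gaussian process indexed by `ℝ` with constant mean and differentiable
paths is constant if the process is orthogonal to its derivative. -/
lemma integral_sq_eq_of_orthogonal {X X' : ℝ → Ω → ℝ} {c : ℝ}
    (hX : IsGaussianProcess X μ) (hmean : ∀ r, ∫ ω, X r ω ∂μ = c)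
    (hd : ∀ ω s, HasDerivAt (fun r => X r ω) (X' s ω) s)
    (horth : ∀ s, MemLp (X' s) 2 μ → ∫ ω, X' s ω * X s ω ∂μ = 0) (a b : ℝ) :
    ∫ ω, X a ω ^ 2 ∂μ = ∫ ω, X b ω ^ 2 ∂μ := by
  let F : ℝ → Lp ℝ 2 μ := fun r => (hX.hasGaussianLaw_eval r).memLp_two.toLp (X r)
  have hF : ∀ r, F r =ᵐ[μ] X r := fun r => MemLp.coeFn_toLp _
  have hderiv : ∀ s, HasDerivAt (fun r => inner ℝ (F r) (F r)) 0 s := by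
    intro s
    obtain ⟨hX', hs⟩ := exists_hasDerivAt_toLp hX hmean (fun ω => hd ω s)
    have h0 : inner ℝ (hX'.toLp (X' s)) (F s) = 0 := by
      rw [L2.inner_def, ← horth s hX']
      refine integral_congr_ae ?_
      filter_upwards [hX'.coeFn_toLp, hF s] with ω h1 h2
      simp [h1, h2, mul_comm]
    have := HasDerivAt.inner ℝ hs hs
    rwa [real_inner_comm, h0, add_zero] at this
  have hsq : ∀ r, ∫ ω, X r ω ^ 2 ∂μ = inner ℝ (F r) (F r) := by
    intro r
    rw [L2.inner_def]
    refine integral_congr_ae ?_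
    filter_upwards [hF r] with ω h
    simp [h, sq]
  rw [hsq, hsq]
  exact is_const_of_deriv_eq_zero (fun s => (hderiv s).differentiableAt)
    (fun s => (hderiv s).deriv) a b

/-- Gaussian vectors whose one-dimensional marginals have the same first and second moments have
the same law. -/
lemma identDistrib_of_integral_inner_eq {E : Type*} [NormedAddCommGroup E] [InnerProductSpace ℝ E]
    [CompleteSpace E] [SecondCountableTopology E] [MeasurableSpace E] [BorelSpace E] {X Y : Ω → E}
    (hX : HasGaussianLaw X μ) (hY : HasGaussianLaw Y μ)
    (h1 : ∀ u, ∫ ω, inner ℝ u (X ω) ∂μ = ∫ ω, inner ℝ u (Y ω) ∂μ)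
    (h2 : ∀ u, ∫ ω, inner ℝ u (X ω) ^ 2 ∂μ = ∫ ω, inner ℝ u (Y ω) ^ 2 ∂μ) :
    IdentDistrib X Y μ μ := by
  have hp : IsProbabilityMeasure μ := hX.isProbabilityMeasure
  have := hX.isGaussian_map
  have := hY.isGaussian_map
  refine ⟨hX.aemeasurable, hY.aemeasurable, Measure.ext_of_charFun (funext fun u => ?_)⟩
  rw [hX.charFun_map_eq, hY.charFun_map_eq,
    variance_eq_sub (X := fun ω => inner ℝ u (X ω)) (hX.map_fun (innerSL ℝ u)).memLp_two,
    variance_eq_sub (X := fun ω => inner ℝ u (Y ω)) (hY.map_fun (innerSL ℝ u)).memLp_two]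
  simp only [Pi.pow_apply, h1, h2]

end Gaussian

section Calculus

lemma hasDerivAt_comp_line {f : Space → ℝ} (hf : Differentiable ℝ f) (x e : Space) (s : ℝ) :
    HasDerivAt (fun r : ℝ => f (x + r • e)) (∑ k, e k * pd k f (x + s • e)) s := by
  have hline : HasDerivAt (fun r : ℝ => x + r • e) e s := by
    simpa using ((hasDerivAt_id s).smul_const e).const_add x
  have h := (hf (x + s • e)).hasFDerivAt.comp_hasDerivAt s hline
  have he : e = ∑ k, e k • EuclideanSpace.single k (1 : ℝ) := by
    ext j; simp [Finset.sum_apply, Pi.single_apply]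
  have hsum : fderiv ℝ f (x + s • e) e = ∑ k, e k * pd k f (x + s • e) := by
    conv_lhs => rw [congrArg (fderiv ℝ f (x + s • e)) he]
    simp only [map_sum, map_smul, smul_eq_mul, pd]
  rwa [hsum] at h

lemma contDiff_pd {f : Space → ℝ} (hf : ContDiff ℝ ((⊤ : ℕ∞) : WithTop ℕ∞) f) (k : Fin 3) :
    ContDiff ℝ ((⊤ : ℕ∞) : WithTop ℕ∞) (pd k f) :=
  (hf.fderiv_right (by simp)).clm_apply contDiff_const

lemma contDiff_curl_apply {v : Space → Space}
    (hv : ∀ i, ContDiff ℝ ((⊤ : ℕ∞) : WithTop ℕ∞) fun y => v y i) (i : Fin 3) :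
    ContDiff ℝ ((⊤ : ℕ∞) : WithTop ℕ∞) fun y => curl v y i := by
  fin_cases i <;> simp only [curl] <;>
    exact (contDiff_pd (hv _) _).sub (contDiff_pd (hv _) _)

end Calculus

section Flow

variable {Ω : Type*} [MeasurableSpace Ω] {ν : ℝ} {U : Space → ℝ → Ω → Space}
  {P : Space → ℝ → Ω → ℝ}

lemma IsRandomFlow.contDiff_velocity_apply (h : IsRandomFlow ν U P) (ω : Ω) {t : ℝ} (ht : 0 ≤ t)
    (i : Fin 3) : ContDiff ℝ ((⊤ : ℕ∞) : WithTop ℕ∞) fun y => U y t ω i := by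
  have h1 : ContDiff ℝ ((⊤ : ℕ∞) : WithTop ℕ∞) fun y : Space => U y t ω := by
    rw [← contDiffOn_univ]
    exact (h.smooth_velocity ω).comp (contDiff_id.prodMk contDiff_const).contDiffOn
      (fun y _ => ⟨Set.mem_univ _, ht⟩)
  exact (EuclideanSpace.proj (𝕜 := ℝ) i).contDiff.comp h1

lemma IsRandomFlow.differentiable_vorticity_apply (h : IsRandomFlow ν U P) (ω : Ω) {t : ℝ}
    (ht : 0 ≤ t) (i : Fin 3) : Differentiable ℝ fun y => vorticity U y t ω i :=
  (contDiff_curl_apply (fun i => h.contDiff_velocity_apply ω ht i) i).differentiable (by simp)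

lemma IsRandomFlow.measurable_pd_velocity (h : IsRandomFlow ν U P) {t : ℝ} (ht : 0 ≤ t)
    (i k : Fin 3) (x : Space) : Measurable fun ω => pd k (fun y => U y t ω i) x := by
  refine measurable_of_hasDerivAt (s := 0)
    (F := fun r ω => U (x + r • EuclideanSpace.single k 1) t ω i) (fun r => ?_) fun ω => ?_
  · have := h.measurable_velocity (x + r • EuclideanSpace.single k 1) t ht
    fun_prop
  · simpa [Pi.single_apply] using hasDerivAt_comp_line
      ((h.contDiff_velocity_apply ω ht i).differentiable (by simp)) x (EuclideanSpace.single k 1) 0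

lemma IsRandomFlow.measurable_vorticity (h : IsRandomFlow ν U P) {t : ℝ} (ht : 0 ≤ t)
    (x : Space) : Measurable (vorticity U x t) := by
  refine (WithLp.measurable_toLp 2 (Fin 3 → ℝ)).comp (measurable_pi_iff.2 fun i => ?_)
  fin_cases i <;>
    exact (h.measurable_pd_velocity ht _ _ x).sub (h.measurable_pd_velocity ht _ _ x)

/-- The second moments of a linear functional of the vorticity do not depend on the point. -/
lemma integral_inner_vorticity_sq_eq {μ : Measure Ω} [IsProbabilityMeasure μ]
    (hflow : IsRandomFlow ν U P) {m : ℝ → Space}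
    (hmean : ∀ x t, 0 ≤ t → ∫ ω, vorticity U x t ω ∂μ = m t)
    (hiso : WeaklyIsotropic μ (vorticity U)) {t : ℝ} (ht : 0 ≤ t)
    (hgauss : IsGaussianProcess (fun x : Space => vorticity U x t) μ) (u x y : Space) :
    ∫ ω, inner ℝ u (vorticity U x t ω) ^ 2 ∂μ = ∫ ω, inner ℝ u (vorticity U y t ω) ^ 2 ∂μ := by
  -- The field is restricted to the line through `x` and `y`, with parameters 0 and 1 at these
  -- points.
  set e := y - x with he
  have key := integral_sq_eq_of_orthogonal (μ := μ)
    (X := fun r ω => inner ℝ u (vorticity U (x + r • e) t ω))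
    (X' := fun r ω => ∑ p : Fin 3 × Fin 3,
      (u p.1 * e p.2) * pd p.2 (fun z => vorticity U z t ω p.1) (x + r • e))
    (c := inner ℝ u (m t)) ?_ ?_ ?_ ?_ 0 1
  · simpa [he] using key
  · exact (hgauss.comp_right (fun r : ℝ => x + r • e)).comp_left fun _ => innerSL ℝ u
  · intro r
    rw [← hmean (x + r • e) t ht]
    exact integral_inner (hgauss.hasGaussianLaw_eval _).integrable u
  · intro ω s
    have hs : HasDerivAt (fun r => ∑ i, u i * vorticity U (x + r • e) t ω i)
        (∑ i, u i * ∑ k, e k * pd k (fun z => vorticity U z t ω i) (x + s • e)) s :=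
      HasDerivAt.fun_sum fun i _ => (hasDerivAt_comp_line
        (hflow.differentiable_vorticity_apply ω ht i) x e s).const_mul (u i)
    have h1 : ∀ r : ℝ, inner ℝ u (vorticity U (x + r • e) t ω)
        = ∑ i, u i * vorticity U (x + r • e) t ω i := fun r => by
      simp [PiLp.inner_apply, mul_comm]
    simp only [h1, Fintype.sum_prod_type]
    simpa only [Finset.mul_sum, mul_assoc] using hs
  · intro s hs
    -- The derivative is a deterministic combination of the `∂Wⁱ/∂xᵏ`, and `⟨u, W⟩` is measurable
    -- for the conditioning sigma-algebra. The product is integrable because both factors are in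
    -- `L²`.
    refine integral_mul_eq_zero_of_condExp_eq_zero
      (hflow.measurable_vorticity ht (x + s • e)).comap_le ?_ ?_ (hs.integrable (by simp))
      (condExp_finsetSum_mul_eq_zero Finset.univ (fun p : Fin 3 × Fin 3 => u p.1 * e p.2)
        (f := fun p ω => pd p.2 (fun z => vorticity U z t ω p.1) (x + s • e))
        (fun p _ => (hiso _ t ht p.1 p.2).1) (fun p _ => (hiso _ t ht p.1 p.2).2))
    · exact ((innerSL ℝ u).continuous.measurable.comp
        (comap_measurable (vorticity U (x + s • e) t))).stronglyMeasurable
    · exact hs.integrable_mul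
        ((hgauss.hasGaussianLaw_eval (x + s • e)).map_fun (innerSL ℝ u)).memLp_two

end Flow

end Turbulence

theorem theorem2 {Ω : Type*} [MeasurableSpace Ω] (μ : Measure Ω) [IsProbabilityMeasure μ]
    (ν : ℝ) (hν : 0 < ν)
    (U : Turbulence.Space → ℝ → Ω → Turbulence.Space) (P : Turbulence.Space → ℝ → Ω → ℝ)
    (hflow : Turbulence.IsRandomFlow ν U P)
    (hmean : ∃ m : ℝ → Turbulence.Space, ∀ x t, 0 ≤ t →
      ∫ ω, Turbulence.vorticity U x t ω ∂μ = m t)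
    (hiso : Turbulence.WeaklyIsotropic μ (Turbulence.vorticity U))
    (hgauss : ∀ t, 0 ≤ t →
      IsGaussianProcess (fun x : Turbulence.Space => Turbulence.vorticity U x t) μ) :
    ∀ t, 0 ≤ t → ∀ x y : Turbulence.Space,
      IdentDistrib (Turbulence.vorticity U x t) (Turbulence.vorticity U y t) μ μ := by
  obtain ⟨m, hm⟩ := hmean
  intro t ht x y
  have hG := fun z => (hgauss t ht).hasGaussianLaw_eval z
  refine Turbulence.identDistrib_of_integral_inner_eq (hG x) (hG y) (fun u => ?_)
    (fun u => Turbulence.integral_inner_vorticity_sq_eq hflow hm hiso ht (hgauss t ht) u x y)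
  rw [integral_inner (hG x).integrable, integral_inner (hG y).integrable, hm x t ht, hm y t ht]
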